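/- All structures are finite. A hypergraph $H$ consists of a finite vertex set $V(H)$ and a set $E(H)$ of subsets of $V(H)$, called edges; it is $3$-uniform if every edge has exactly three elements. A module of $H$ is a set $M\subseteq V(H)$ such that for each $e\in E(H)$ with $e\cap M\neq\emptyset$ and $e\setminus M\neq\emptyset$, there exists $m\in M$ such that $e\cap M=\{m\}$ and, for every $n\in M$, $(e\setminus\{m\})\cup\{n\}\in E(H)$. A module of a tournament $T$ is a set $M\subseteq V(T)$ such that for all $x,y\in M$ and $v\in V(T)$, if $xv$ and $vy$ are arcs of $T$, then $v\in M$. For a hypergraph or a tournament with vertex set $V$, the trivial modules are $\emptyset$, $V$ and the singletons $\{v\}$ with $v\in V$; the hypergraph or tournament is prime if $|V|\geq 3$ and all its modules are trivial. A tournament $T$ is a realization of a $3$-uniform hypergraph $H$ if $V(T)=V(H)$ and the edges of $H$ are exactly the sets $X\subseteq V(T)$ such that the subtournament $T[X]$ is isomorphic to the $3$-cycle $(\{0,1,2\},\{01,12,20\})$; $H$ is realizable if it has a realization. **Theorem.** Let $H$ be a realizable $3$-uniform hypergraph, and let $T$ be a realization of $H$. Then $H$ is prime if and only if $T$ is prime.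 -/

import Mathlib

namespace Hypergraph

/-- `H` is `k`-uniform: every edge has exactly `k` elements. -/
def IsUniform {α : Type*} (H : Hypergraph α) (k : ℕ) : Prop :=
  ∀ e ∈ H.edgeSet, e.encard = k

/-- `M` is a module of the hypergraph `H`: `M ⊆ V(H)`, and for each edge `e` that meets both `M` and
its complement there is `m ∈ M` with `e ∩ M = {m}` such that `(e \ {m}) ∪ {n}` is an edge for every
`n ∈ M`. -/
def IsModule {α : Type*} (H : Hypergraph α) (M : Set α) : Prop :=
  M ⊆ H.vertexSet ∧
    ∀ e ∈ H.edgeSet, (e ∩ M).Nonempty → (e \ M).Nonempty →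
      ∃ m ∈ M, e ∩ M = {m} ∧ ∀ n ∈ M, (e \ {m}) ∪ {n} ∈ H.edgeSet

/-- All modules of `H` are trivial, i.e. equal to `∅`, to `V(H)` or to `{v}` with `v ∈ V(H)`. -/
def IsIndecomposable {α : Type*} (H : Hypergraph α) : Prop :=
  ∀ M, H.IsModule M → M = ∅ ∨ M = H.vertexSet ∨ ∃ v ∈ H.vertexSet, M = {v}

/-- `H` is prime: it is indecomposable and has at least three vertices. -/
def IsPrime {α : Type*} (H : Hypergraph α) : Prop :=
  H.IsIndecomposable ∧ 3 ≤ H.vertexSet.encard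

end Hypergraph

/-- A tournament with vertices of type `α`: a vertex set `V(T)` and a set of arcs between vertices
such that for distinct vertices `x, y` exactly one of `xy` and `yx` is an arc (and there are no
loops). `T.Adj x y` means that `xy` is an arc. -/
structure Tournament (α : Type*) extends Digraph α where
  /-- The vertex set. -/
  vertexSet : Set α
  left_mem : ∀ ⦃x y⦄, Adj x y → x ∈ vertexSet
  right_mem : ∀ ⦃x y⦄, Adj x y → y ∈ vertexSet
  asymm : ∀ ⦃x y⦄, Adj x y → ¬ Adj y x
  total : ∀ ⦃x y⦄, x ∈ vertexSet → y ∈ vertexSet → x ≠ y → Adj x y ∨ Adj y x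

namespace Tournament

/-- The 3-cycle `C₃`, with vertices `0, 1, 2` and arcs `01, 12, 20`. -/
def cycle3 : Tournament (Fin 3) where
  Adj i j := j = i + 1
  vertexSet := Set.univ
  left_mem _ _ _ := trivial
  right_mem _ _ _ := trivial
  asymm := by decide
  total := by
    have h : ∀ x y : Fin 3, x ≠ y → y = x + 1 ∨ x = y + 1 := by decide
    exact fun x y _ _ hxy => h x y hxy

/-- The subtournament `T[X]` of `T` induced by `X`. -/
def induce {α : Type*} (T : Tournament α) (X : Set α) : Tournament α where
  Adj x y := x ∈ X ∧ y ∈ X ∧ T.Adj x y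
  vertexSet := T.vertexSet ∩ X
  left_mem _ _ h := ⟨T.left_mem h.2.2, h.1⟩
  right_mem _ _ h := ⟨T.right_mem h.2.2, h.2.1⟩
  asymm _ _ h h' := T.asymm h.2.2 h'.2.2
  total _ _ hx hy hxy :=
    (T.total hx.1 hy.1 hxy).imp (fun h => ⟨hx.2, hy.2, h⟩) (fun h => ⟨hy.2, hx.2, h⟩)

/-- `T` and `T'` are isomorphic: some bijection between the vertex sets preserves and reflects
arcs. -/
def IsIsomorphic {α β : Type*} (T : Tournament α) (T' : Tournament β) : Prop :=
  ∃ f : T.vertexSet ≃ T'.vertexSet, ∀ x y : T.vertexSet, T.Adj x y ↔ T'.Adj (f x) (f y)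

/-- The `C₃`-structure of `T`: the hypergraph on `V(T)` whose edges are the `X ⊆ V(T)` such that
`T[X]` is isomorphic to the 3-cycle. -/
def c3Structure {α : Type*} (T : Tournament α) : Hypergraph α where
  vertexSet := T.vertexSet
  edgeSet := {X | X ⊆ T.vertexSet ∧ (T.induce X).IsIsomorphic cycle3}
  subset_vertexSet_of_mem_edgeSet' _ h := h.1

/-- `T` is a realization of `H`: `V(T) = V(H)` and `H` is the `C₃`-structure of `T`. -/
def Realizes {α : Type*} (T : Tournament α) (H : Hypergraph α) : Prop :=
  T.vertexSet = H.vertexSet ∧ H = T.c3Structure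

/-- `M` is a module of the tournament `T`: `M ⊆ V(T)`, and every vertex `v` such that `xv` and `vy`
are arcs for some `x, y ∈ M` belongs to `M`. -/
def IsModule {α : Type*} (T : Tournament α) (M : Set α) : Prop :=
  M ⊆ T.vertexSet ∧
    ∀ x ∈ M, ∀ y ∈ M, ∀ v ∈ T.vertexSet, T.Adj x v → T.Adj v y → v ∈ M

/-- All modules of `T` are trivial, i.e. equal to `∅`, to `V(T)` or to `{v}` with `v ∈ V(T)`. -/
def IsIndecomposable {α : Type*} (T : Tournament α) : Prop :=
  ∀ M, T.IsModule M → M = ∅ ∨ M = T.vertexSet ∨ ∃ v ∈ T.vertexSet, M = {v}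

/-- `T` is prime: it is indecomposable and has at least three vertices. -/
def IsPrime {α : Type*} (T : Tournament α) : Prop :=
  T.IsIndecomposable ∧ 3 ≤ T.vertexSet.encard

end Tournament

namespace Hypergraph

/-- `H` is realizable: it admits a realization. -/
def IsRealizable {α : Type*} (H : Hypergraph α) : Prop :=
  ∃ T : Tournament α, T.Realizes H

end Hypergraph

namespace Tournament

variable {α : Type*} (T : Tournament α)

/-! Modules of `T` are modules of `H`. Conversely, let `M` be a nontrivial module of `H` and `T`
prime. Adding to `M` all vertices that separate it gives a module of `T`
(`isModule_union_separating`), hence all of `V`: each outside `v` has in- and out-neighbours in `M`.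
The former dominate the latter, since otherwise a 3-cycle would meet `M` in two vertices. So the
in-neighbourhoods in `M` form a chain; the smallest one, `A`, dominates everything else, and `V \ A`
is a nontrivial module of `T`. -/

theorem ne_of_adj {x y : α} (h : T.Adj x y) : x ≠ y := by
  rintro rfl
  exact T.asymm h h

theorem adj_of_not_adj {x y : α} (hx : x ∈ T.vertexSet) (hy : y ∈ T.vertexSet) (hxy : x ≠ y)
    (h : ¬ T.Adj x y) : T.Adj y x :=
  (T.total hx hy hxy).resolve_left h

/-- The edges of the `C₃`-structure are the vertex sets of the directed triangles. -/
theorem mem_edgeSet_c3Structure {X : Set α} :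
    X ∈ T.c3Structure.edgeSet ↔
      ∃ x y z, T.Adj x y ∧ T.Adj y z ∧ T.Adj z x ∧ X = {x, y, z} := by
  constructor
  · rintro ⟨hX, f, hf⟩
    let g : Fin 3 → (T.induce X).vertexSet := fun i => f.symm ⟨i, trivial⟩
    have hg (i : Fin 3) : T.Adj (g i) (g (i + 1)) := by
      refine ((hf (g i) (g (i + 1))).2 ?_).2.2
      change cycle3.Adj (f (f.symm _)) (f (f.symm _))
      rw [f.apply_symm_apply, f.apply_symm_apply]
      rfl
    refine ⟨g 0, g 1, g 2, hg 0, hg 1, hg 2, ?_⟩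
    ext v
    simp only [Set.mem_insert_iff, Set.mem_singleton_iff]
    constructor
    · intro hv
      have hv' : v ∈ (T.induce X).vertexSet := ⟨hX hv, hv⟩
      obtain ⟨i, hi⟩ : ∃ i : Fin 3, v = g i :=
        ⟨(f ⟨v, hv'⟩).1, (congrArg Subtype.val (f.symm_apply_apply ⟨v, hv'⟩)).symm⟩
      fin_cases i
      · exact Or.inl hi
      · exact Or.inr (Or.inl hi)
      · exact Or.inr (Or.inr hi)
    · rintro (rfl | rfl | rfl)
      exacts [(g 0).2.2, (g 1).2.2, (g 2).2.2]
  · rintro ⟨x, y, z, hxy, hyz, hzx, rfl⟩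
    have hsub : ({x, y, z} : Set α) ⊆ T.vertexSet := by
      rintro v (rfl | rfl | rfl)
      exacts [T.left_mem hxy, T.left_mem hyz, T.left_mem hzx]
    refine ⟨hsub, ?_⟩
    have hmem : ∀ i : Fin 3, ![x, y, z] i ∈ (T.induce {x, y, z}).vertexSet := by
      intro i
      have : ![x, y, z] i ∈ ({x, y, z} : Set α) := by fin_cases i <;> simp
      exact ⟨hsub this, this⟩
    let g : cycle3.vertexSet → (T.induce {x, y, z}).vertexSet := fun i => ⟨![x, y, z] i, hmem i⟩
    have hadj (i j : cycle3.vertexSet) :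
        (T.induce {x, y, z}).Adj (g i) (g j) ↔ cycle3.Adj i j := by
      have key : T.Adj (![x, y, z] i.1) (![x, y, z] j.1) ↔ j.1 = i.1 + 1 := by
        obtain ⟨i, -⟩ := i
        obtain ⟨j, -⟩ := j
        have hirr (v : α) : ¬ T.Adj v v := fun h => T.asymm h h
        fin_cases i <;> fin_cases j <;>
          simp [hxy, hyz, hzx, hirr, T.asymm hxy, T.asymm hyz, T.asymm hzx]
      exact ⟨fun h => key.1 h.2.2, fun h => ⟨(hmem i).2, (hmem j).2, key.2 h⟩⟩
    have hbij : Function.Bijective g := by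
      constructor
      · intro i j hij
        by_contra hne
        rcases cycle3.total i.2 j.2 (fun h => hne (Subtype.ext h)) with h | h
        · exact T.ne_of_adj ((hadj i j).2 h).2.2 (congrArg Subtype.val hij)
        · exact T.ne_of_adj ((hadj j i).2 h).2.2 (congrArg Subtype.val hij).symm
      · rintro ⟨v, hv, rfl | rfl | rfl⟩
        exacts [⟨⟨0, trivial⟩, rfl⟩, ⟨⟨1, trivial⟩, rfl⟩, ⟨⟨2, trivial⟩, rfl⟩]
    refine ⟨(Equiv.ofBijective g hbij).symm, fun u v => ?_⟩
    have h := hadj ((Equiv.ofBijective g hbij).symm u) ((Equiv.ofBijective g hbij).symm v)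
    have hu : g ((Equiv.ofBijective g hbij).symm u) = u :=
      (Equiv.ofBijective g hbij).apply_symm_apply u
    have hv : g ((Equiv.ofBijective g hbij).symm v) = v :=
      (Equiv.ofBijective g hbij).apply_symm_apply v
    rwa [hu, hv] at h

variable {T} {M : Set α}

/-- Two vertices of a 3-cycle in `M` force the third, and all of `M` relates to an outside vertex
alike. Taking `x` as the vertex in `M` costs only a rotation. -/
theorem IsModule.exists_replace (hM : T.IsModule M) {x y z : α} (hxy : T.Adj x y)
    (hyz : T.Adj y z) (hzx : T.Adj z x) (hx : x ∈ M) (hne : (({x, y, z} : Set α) \ M).Nonempty) :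
    ∃ m ∈ M, ({x, y, z} : Set α) ∩ M = {m} ∧
      ∀ n ∈ M, (({x, y, z} : Set α) \ {m}) ∪ {n} ∈ T.c3Structure.edgeSet := by
  have hyV := T.right_mem hxy
  have hzV := T.left_mem hzx
  have hyM : y ∉ M := by
    intro hy
    have hz := hM.2 y hy x hx z hzV hyz hzx
    obtain ⟨v, rfl | rfl | rfl, hv⟩ := hne <;> contradiction
  have hzM : z ∉ M := fun hz => hyM (hM.2 x hx z hz y hyV hxy hyz)
  refine ⟨x, hx, ?_, fun n hn => ?_⟩
  · ext v
    constructor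
    · rintro ⟨rfl | rfl | rfl, hv⟩
      exacts [rfl, (hyM hv).elim, (hzM hv).elim]
    · rintro rfl
      exact ⟨Or.inl rfl, hx⟩
  · have hny : T.Adj n y := T.adj_of_not_adj hyV (hM.1 hn) (fun h => hyM (h ▸ hn))
      (fun h => hyM (hM.2 x hx n hn y hyV hxy h))
    have hzn : T.Adj z n := T.adj_of_not_adj (hM.1 hn) hzV (fun h => hzM (h ▸ hn))
      (fun h => hzM (hM.2 n hn x hx z hzV h hzx))
    refine T.mem_edgeSet_c3Structure.2 ⟨n, y, z, hny, hyz, hzn, ?_⟩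
    have h1 := T.ne_of_adj hxy
    have h2 := T.ne_of_adj hzx
    ext v
    simp only [Set.mem_union, Set.mem_sdiff, Set.mem_insert_iff, Set.mem_singleton_iff]
    grind

/-- Every module of a tournament is a module of its `C₃`-structure. -/
theorem IsModule.c3Structure (hM : T.IsModule M) : T.c3Structure.IsModule M := by
  refine ⟨hM.1, fun e he hmeet hne => ?_⟩
  obtain ⟨x, y, z, hxy, hyz, hzx, rfl⟩ := T.mem_edgeSet_c3Structure.1 he
  have h1 : ({x, y, z} : Set α) = {y, z, x} := by ext; simp; tauto
  have h2 : ({x, y, z} : Set α) = {z, x, y} := by ext; simp; tauto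
  obtain ⟨v, rfl | rfl | rfl, hv⟩ := hmeet
  · exact hM.exists_replace hxy hyz hzx hv hne
  · rw [h1] at hne ⊢
    exact hM.exists_replace hyz hzx hxy hv hne
  · rw [h2] at hne ⊢
    exact hM.exists_replace hzx hxy hyz hv hne

/-- Outside a module of the `C₃`-structure, the in-neighbours in the module dominate the
out-neighbours in the module. -/
theorem adj_of_c3Structure_isModule (hM : T.c3Structure.IsModule M) {v x y : α} (hv : v ∉ M)
    (hx : x ∈ M) (hy : y ∈ M) (hxv : T.Adj x v) (hvy : T.Adj v y) : T.Adj x y := by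
  have hne : x ≠ y := by
    rintro rfl
    exact T.asymm hxv hvy
  refine T.adj_of_not_adj (hM.1 hy) (hM.1 hx) hne.symm fun hyx => ?_
  obtain ⟨m, -, hm, -⟩ := hM.2 {x, v, y}
    (T.mem_edgeSet_c3Structure.2 ⟨x, v, y, hxv, hvy, hyx, rfl⟩)
    ⟨x, by simp, hx⟩ ⟨v, by simp, hv⟩
  have h1 : x ∈ ({m} : Set α) := hm ▸ ⟨by simp, hx⟩
  have h2 : y ∈ ({m} : Set α) := hm ▸ ⟨by simp, hy⟩
  exact hne (h1.trans h2.symm)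

/-- If `ab` is an arc between vertices outside a module `M` of the `C₃`-structure and some vertex
of `M` forms a directed triangle with `a` and `b`, then all vertices of `M` do. -/
theorem adj_adj_of_c3Structure_isModule (hM : T.c3Structure.IsModule M) {a b m n : α}
    (ha : a ∉ M) (hb : b ∉ M) (hm : m ∈ M) (hn : n ∈ M) (hab : T.Adj a b) (hbm : T.Adj b m)
    (hma : T.Adj m a) : T.Adj b n ∧ T.Adj n a := by
  obtain ⟨m', hm'M, hm', hrep⟩ := hM.2 {a, b, m}
    (T.mem_edgeSet_c3Structure.2 ⟨a, b, m, hab, hbm, hma, rfl⟩)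
    ⟨m, by simp, hm⟩ ⟨a, by simp, ha⟩
  obtain rfl : m = m' := (hm' ▸ ⟨by simp, hm⟩ : m ∈ ({m'} : Set α))
  obtain ⟨x, y, z, hxy, hyz, hzx, he⟩ := T.mem_edgeSet_c3Structure.1 (hrep n hn)
  have h1 := T.ne_of_adj hbm
  have h2 := T.ne_of_adj hma
  have hset (v : α) : (v = a ∨ v = b ∨ v = n) ↔ (v = x ∨ v = y ∨ v = z) := by
    have := Set.ext_iff.1 he v
    simp only [Set.mem_union, Set.mem_sdiff, Set.mem_insert_iff, Set.mem_singleton_iff] at this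
    grind
  have hba := T.asymm hab
  have ha' := (hset a).1 (by simp)
  have hb' := (hset b).1 (by simp)
  have hn' := (hset n).1 (by simp)
  -- Only rotations of `a → b → n → a` survive: coinciding vertices are impossible, and the reverse
  -- cycle contains `b → a`.
  rcases ha' with rfl | rfl | rfl <;> rcases hb' with rfl | rfl | rfl <;>
    rcases hn' with rfl | rfl | rfl <;> first | contradiction | exact ⟨by assumption, by assumption⟩

/-- A module of the `C₃`-structure together with the vertices that separate it is a module of the
tournament. -/
theorem isModule_union_separating (hM : T.c3Structure.IsModule M) :
    T.IsModule (M ∪ {v | ∃ x ∈ M, ∃ y ∈ M, T.Adj x v ∧ T.Adj v y}) := by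
  refine ⟨?_, fun a ha b hb v hv hav hvb => ?_⟩
  · rintro v (hv | ⟨x, -, y, -, hxv, -⟩)
    exacts [hM.1 hv, T.right_mem hxv]
  by_contra hvS
  have hvM : v ∉ M := fun h => hvS (Or.inl h)
  have hsep {x y : α} (hx : x ∈ M) (hy : y ∈ M) (hxv : T.Adj x v) : ¬ T.Adj v y :=
    fun hvy => hvS (Or.inr ⟨x, hx, y, hy, hxv, hvy⟩)
  have hadj {m : α} (hm : m ∈ M) : T.Adj m v ∨ T.Adj v m :=
    T.total (hM.1 hm) hv fun h => hvM (h ▸ hm)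
  have hout (h : ∃ m ∈ M, T.Adj v m) : False := by
    obtain ⟨m, hm, hvm⟩ := h
    have hall {n : α} (hn : n ∈ M) : T.Adj v n := (hadj hn).resolve_left fun h => hsep hn hm h hvm
    have haM : a ∉ M := fun h => T.asymm hav (hall h)
    obtain ⟨x, hx, y, hy, hxa, hay⟩ := ha.resolve_left haM
    -- The 3-cycle `a → v → x → a` transfers from `x` to `y`, giving `y → a` against `a → y`.
    exact T.asymm hay
      (adj_adj_of_c3Structure_isModule hM haM hvM hx hy hav (hall hx) hxa).2
  have hin (h : ∃ m ∈ M, T.Adj m v) : False := by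
    obtain ⟨m, hm, hmv⟩ := h
    have hall {n : α} (hn : n ∈ M) : T.Adj n v := (hadj hn).resolve_right fun h => hsep hm hn hmv h
    have hbM : b ∉ M := fun h => T.asymm hvb (hall h)
    obtain ⟨x, hx, y, hy, hxb, hby⟩ := hb.resolve_left hbM
    exact T.asymm hxb
      (adj_adj_of_c3Structure_isModule hM hvM hbM hy hx hvb hby (hall hy)).1
  have hMne : M.Nonempty := by
    rcases ha with h | ⟨x, hx, -⟩
    exacts [⟨a, h⟩, ⟨x, hx⟩]
  obtain ⟨m, hm⟩ := hMne
  exact (hadj hm).elim (fun h => hin ⟨m, hm, h⟩) (fun h => hout ⟨m, hm, h⟩)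

/-- If every vertex outside a proper module of the `C₃`-structure separates it, then the tournament
is decomposable. -/
theorem not_isIndecomposable_of_separating (hfin : T.vertexSet.Finite)
    (hM : T.c3Structure.IsModule M) (hMV : M ≠ T.vertexSet)
    (hsep : ∀ v ∈ T.vertexSet \ M, ∃ x ∈ M, ∃ y ∈ M, T.Adj x v ∧ T.Adj v y) :
    ¬ T.IsIndecomposable := by
  intro hT
  have hMfin : M.Finite := hfin.subset hM.1
  have hout : (T.vertexSet \ M).Nonempty := by
    rw [Set.sdiff_nonempty]
    exact fun h => hMV (hM.1.antisymm h)
  obtain ⟨a, ⟨haV, haM⟩, hmin⟩ := Set.exists_min_image (T.vertexSet \ M)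
    (fun v => {x ∈ M | T.Adj x v}.ncard) (hfin.subset Set.sdiff_subset) hout
  have hle {v x : α} (hv : v ∈ T.vertexSet) (hvM : v ∉ M) (hx : x ∈ M) (hxa : T.Adj x a) :
      T.Adj x v := by
    by_contra hxv
    have hvx := T.adj_of_not_adj (hM.1 hx) hv (fun h => hvM (h ▸ hx)) hxv
    -- If `v → x`, the in-neighbours of `v` in `M` lie in `A` and miss `x`, against minimality: such
    -- a `y` dominates `x`, whereas `a → y` would give `x → y`.
    refine (hmin v ⟨hv, hvM⟩).not_gt (Set.ncard_lt_ncard ?_ (hMfin.subset (Set.sep_subset _ _)))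
    refine ⟨fun y hy => ⟨hy.1, ?_⟩, fun h => hxv (h ⟨hx, hxa⟩).2⟩
    by_contra hya
    have hay := T.adj_of_not_adj (hM.1 hy.1) haV (fun h => haM (h ▸ hy.1)) hya
    exact T.asymm (adj_of_c3Structure_isModule hM haM hx hy.1 hxa hay)
      (adj_of_c3Structure_isModule hM hvM hy.1 hx hy.2 hvx)
  -- No arc enters `A` from outside, whether from `M \ A` or from `V \ M`.
  have hmod : T.IsModule (T.vertexSet \ {x ∈ M | T.Adj x a}) := by
    refine ⟨Set.sdiff_subset, fun x hx y _ v hv hxv _ => ⟨hv, fun hvA => T.asymm hxv ?_⟩⟩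
    by_cases hxM : x ∈ M
    · exact adj_of_c3Structure_isModule hM haM hvA.1 hxM hvA.2
        (T.adj_of_not_adj hx.1 haV (fun h => haM (h ▸ hxM)) fun h => hx.2 ⟨hxM, h⟩)
    · exact hle hx.1 hxM hvA.1 hvA.2
  obtain ⟨x, hx, y, hy, hxa, hay⟩ := hsep a ⟨haV, haM⟩
  have ha : a ∈ T.vertexSet \ {x ∈ M | T.Adj x a} := ⟨haV, fun h => haM h.1⟩
  have hy' : y ∈ T.vertexSet \ {x ∈ M | T.Adj x a} := ⟨hM.1 hy, fun h => T.asymm hay h.2⟩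
  rcases hT _ hmod with h | h | ⟨v, -, h⟩
  · exact Set.notMem_empty a (h ▸ ha)
  · exact (h.symm ▸ hM.1 hx : x ∈ T.vertexSet \ {x ∈ M | T.Adj x a}).2 ⟨hx, hxa⟩
  · rw [h] at ha hy'
    exact T.ne_of_adj hay (ha.trans hy'.symm)

/-- A finite tournament is indecomposable if and only if its `C₃`-structure is. -/
theorem c3Structure_isIndecomposable_iff (hfin : T.vertexSet.Finite) :
    T.c3Structure.IsIndecomposable ↔ T.IsIndecomposable := by
  refine ⟨fun h M hM => h M hM.c3Structure, fun hT M hM => ?_⟩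
  change M = ∅ ∨ M = T.vertexSet ∨ ∃ v ∈ T.vertexSet, M = {v}
  by_contra! hne
  obtain ⟨h0, hV, h1⟩ := hne
  obtain ⟨m, hm⟩ := h0
  rcases hT _ (isModule_union_separating hM) with h | h | ⟨v, hv, h⟩
  · exact Set.notMem_empty m (h ▸ Or.inl hm)
  · refine not_isIndecomposable_of_separating hfin hM hV (fun v hv => ?_) hT
    exact (h.symm ▸ hv.1 :
      v ∈ M ∪ {v | ∃ x ∈ M, ∃ y ∈ M, T.Adj x v ∧ T.Adj v y}).resolve_left hv.2
  · have hsub : M ⊆ {v} := h ▸ Set.subset_union_left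
    exact h1 v hv (hsub.antisymm (by rintro _ rfl; exact hsub hm ▸ hm))

end Tournament

theorem mainTheorem4 {α : Type*} (H : Hypergraph α) (hfin : H.vertexSet.Finite)
    (hunif : H.IsUniform 3) (hreal : H.IsRealizable)
    (T : Tournament α) (hT : T.Realizes H) :
    H.IsPrime ↔ T.IsPrime := by
  obtain ⟨-, rfl⟩ := hT
  exact and_congr (Tournament.c3Structure_isIndecomposable_iff hfin) Iff.rfl
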